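/- Let $g(r)=\sinh(\sqrt r)/\sqrt r$ for $r>0$, $g(0)=1$, and $g(r)=\sin(\sqrt{-r})/\sqrt{-r}$ for $-\pi^2<r<0$; $g$ is a bijection from $(-\pi^2,\infty)$ onto $(0,\infty)$, with inverse $g^{-1}$. For $\eta>0$ let $$G(\eta)=2\eta-2\,\mathrm{sgn}\big(4g^{-1}(\eta^{-1})+\pi^2\big)\sqrt{\eta^2+g^{-1}(\eta^{-1})}+g^{-1}(\eta^{-1}).$$ For real sequences $(a_n)_{n\ge2}$, $(b_n)_{n\ge2}$ set $$G_n(\eta)=a_n\mathbf 1_{(1,\infty)}(\eta)\frac{(\eta-1)^n}{\eta^{n-1}}+b_n\mathbf 1_{(0,1)}(\eta)\frac{(-\log\eta)^n}{(1-\log\eta)^{n-2}},\qquad n\ge 2,$$ and let the coefficients $a_n,b_n$ be determined recursively by the requirement that, for every $n\ge2$, $\sum_{k=2}^nG_k$ is $n$ times continuously differentiable near $\eta=1$ and $$\frac{d^n}{d\eta^n}G(\eta)\Big|_{\eta=1}=\frac{d^n}{d\eta^n}\sum_{k=2}^nG_k(\eta)\Big|_{\eta=1}.$$ If $a_n>0$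 for all $n\ge2$, then $$\lim_{N\to\infty}\sum_{n=2}^Na_n=4 .$$ Hence the truncated expansion reproduces in the limit the asymptotic behaviour of $G$ at infinity: $G(\eta)\sim4\eta$ as $\eta\to\infty$ and, for every $N\ge2$, $\sum_{n=2}^NG_n(\eta)\sim\eta\sum_{n=2}^Na_n$ as $\eta\to\infty$, where $\sum_{n=2}^Na_n\to4$ as $N\to\infty$. (Here $f\sim h$ means $f/h\to1$.) -/

import Mathlib

open Filter Topology Asymptotics

noncomputable section

namespace CostExpansion

/-- The function `g(r) = sinh(√r) / √r`, with `g(0) = 1` and `g(r) = sin(√(-r)) / √(-r)` for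
`r < 0`. Only its values on `(-π², ∞)` are used. -/
def g (r : ℝ) : ℝ :=
  if 0 < r then Real.sinh (Real.sqrt r) / Real.sqrt r
  else if r = 0 then 1
  else Real.sin (Real.sqrt (-r)) / Real.sqrt (-r)

/-- The inverse of `g`, as a function from `(-π², ∞)` onto `(0, ∞)`. -/
def gInv : ℝ → ℝ := Function.invFunOn g (Set.Ioi (-Real.pi ^ 2))

/-- `G(η) = 2η - 2 sgn(4 g⁻¹(1/η) + π²) √(η² + g⁻¹(1/η)) + g⁻¹(1/η)`, for `η > 0`. -/
def G (η : ℝ) : ℝ :=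
  2 * η - 2 * Real.sign (4 * gInv η⁻¹ + Real.pi ^ 2) * Real.sqrt (η ^ 2 + gInv η⁻¹) + gInv η⁻¹

/-- The `n`-th term (`n ≥ 2`) of the expansion of `G`, with coefficients `a n` on `(1, ∞)` and
`b n` on `(0, 1)`. -/
def term (a b : ℕ → ℝ) (n : ℕ) (η : ℝ) : ℝ :=
  a n * (Set.Ioi (1 : ℝ)).indicator (fun x => (x - 1) ^ n / x ^ (n - 1)) η +
    b n * (Set.Ioo (0 : ℝ) 1).indicator
      (fun x => (-Real.log x) ^ n / (1 - Real.log x) ^ (n - 2)) η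

/-- The truncated expansion `∑_{n=2}^N G_n(η)`. -/
def truncated (a b : ℕ → ℝ) (N : ℕ) (η : ℝ) : ℝ :=
  ∑ n ∈ Finset.Icc 2 N, term a b n η

/-- `a` and `b` are the coefficients of the expansion of `G`: for every `n ≥ 2`, the truncated
expansion of order `n` is `n` times continuously differentiable at `1` and its (two-sided) `n`-th
derivative there equals that of `G`. -/
def IsExpansionCoeff (a b : ℕ → ℝ) : Prop :=
  ∀ n : ℕ, 2 ≤ n → ContDiffAt ℝ n (truncated a b n) 1 ∧
    iteratedDeriv n G 1 = iteratedDeriv n (truncated a b n) 1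

/-! Existence of the coefficients: auxiliary facts. -/

theorem exists_triangular (M : ℕ → ℕ → ℝ) (hM : ∀ n, 2 ≤ n → M n n ≠ 0) (c : ℕ → ℝ) :
    ∃ a : ℕ → ℝ, ∀ n, 2 ≤ n → ∑ k ∈ Finset.Icc 2 n, a k * M n k = c n := by
  let F : (n : ℕ) → ((m : ℕ) → m < n → ℝ) → ℝ := fun n ih =>
    (c n - ∑ k ∈ Finset.Ico 2 n, (if h : k < n then ih k h else 0) * M n k) / M n n
  let a : ℕ → ℝ := WellFounded.fix Nat.lt_wfRel.wf F
  have ha : ∀ n, a n = (c n - ∑ k ∈ Finset.Ico 2 n, a k * M n k) / M n n := by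
    intro n
    change WellFounded.fix Nat.lt_wfRel.wf F n = _
    rw [WellFounded.fix_eq]
    change (c n - ∑ k ∈ Finset.Ico 2 n, (if h : k < n then a k else 0) * M n k) / M n n = _
    congr 2
    refine Finset.sum_congr rfl fun k hk => ?_
    rw [dif_pos (Finset.mem_Ico.1 hk).2]
  refine ⟨a, fun n hn => ?_⟩
  rw [← Finset.sum_Ico_add_eq_sum_Icc hn, ha n, div_mul_cancel₀ _ (hM n hn)]
  ring

theorem order_sub_one : analyticOrderAt (fun x : ℝ => x - 1) 1 = 1 := by
  apply AnalyticAt.analyticOrderAt_eq_one_of_zero_deriv_ne_zero (by fun_prop) (by simp)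
  simp

theorem order_neg_log : analyticOrderAt (fun x : ℝ => -Real.log x) 1 = 1 := by
  apply AnalyticAt.analyticOrderAt_eq_one_of_zero_deriv_ne_zero
  · exact (analyticAt_log (by norm_num)).neg
  · simp
  · simp

theorem order_pow_div {f d : ℝ → ℝ} (hf : AnalyticAt ℝ f 1) (hd : AnalyticAt ℝ d 1)
    (h1 : analyticOrderAt f 1 = 1) (hd1 : d 1 ≠ 0) (n m : ℕ) :
    AnalyticAt ℝ (fun x => f x ^ n / d x ^ m) 1 ∧
      analyticOrderAt (fun x => f x ^ n / d x ^ m) 1 = n := by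
  have hi : AnalyticAt ℝ (fun x => (d x ^ m)⁻¹) 1 := (hd.pow m).inv (pow_ne_zero _ hd1)
  have hp : AnalyticAt ℝ (f ^ n) 1 := hf.pow n
  have he : (fun x => f x ^ n / d x ^ m) = (f ^ n) * fun x => (d x ^ m)⁻¹ := by
    ext x; simp [div_eq_mul_inv]
  rw [he]
  refine ⟨hp.mul hi, ?_⟩
  rw [analyticOrderAt_mul hp hi, analyticOrderAt_pow hf, h1,
    hi.analyticOrderAt_eq_zero.2 (inv_ne_zero (pow_ne_zero _ hd1))]
  simp

theorem contDiff_max_pow (n : ℕ) : ContDiff ℝ n (fun x : ℝ => max (x - 1) 0 ^ (n + 1)) := by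
  induction n with
  | zero =>
    simp only [Nat.cast_zero, contDiff_zero]
    fun_prop
  | succ n ih =>
    have hd : ∀ x : ℝ, HasDerivAt (fun x : ℝ => max (x - 1) 0 ^ (n + 1 + 1))
        ((n + 2 : ℝ) * max (x - 1) 0 ^ (n + 1)) x := by
      intro x
      rcases lt_trichotomy x 1 with h | h | h
      · have : (fun x : ℝ => max (x - 1) 0 ^ (n + 1 + 1)) =ᶠ[𝓝 x] fun _ => 0 := by
          filter_upwards [Iio_mem_nhds h] with y hy
          rw [max_eq_right (by linarith [Set.mem_Iio.1 hy])]; simp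
        rw [max_eq_right (by linarith)]
        simpa using (hasDerivAt_const x (0 : ℝ)).congr_of_eventuallyEq this
      · subst h
        rw [hasDerivAt_iff_isLittleO]
        simp only [sub_self, max_self, ne_eq, Nat.add_eq_zero_iff, one_ne_zero, and_false,
          not_false_eq_true, zero_pow, sub_zero, mul_zero, smul_zero]
        have h1 : (fun x : ℝ => max (x - 1) 0 ^ (n + 1 + 1)) =O[𝓝 1]
            fun x : ℝ => (x - 1) ^ (n + 1 + 1) := by
          refine IsBigO.of_bound 1 (Eventually.of_forall fun x => ?_)
          rw [one_mul, norm_pow, norm_pow]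
          refine pow_le_pow_left₀ (norm_nonneg _) ?_ _
          rw [Real.norm_eq_abs, Real.norm_eq_abs]
          rcases le_total (x - 1) 0 with h | h
          · rw [max_eq_right h]; simp
          · rw [max_eq_left h]
        refine h1.trans_isLittleO ?_
        have h2 : (fun x : ℝ => (x - 1) ^ (n + 1 + 1)) =o[𝓝 1] fun x : ℝ => (x - 1) := by
          have := isLittleO_pow_sub_sub (1 : ℝ) (m := n + 2) (by omega)
          refine this.norm_left.congr_left ?_ |>.of_norm_left
          intro x; simp
        exact h2
      · have : (fun x : ℝ => max (x - 1) 0 ^ (n + 1 + 1)) =ᶠ[𝓝 x]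
            fun x => (x - 1) ^ (n + 1 + 1) := by
          filter_upwards [Ioi_mem_nhds h] with y hy
          rw [max_eq_left (by linarith [Set.mem_Ioi.1 hy])]
        rw [max_eq_left (by linarith)]
        have h3 := (((hasDerivAt_id x).sub_const 1).pow (n + 2)).congr_of_eventuallyEq this
        exact h3.congr_deriv (by push_cast; simp)
    have : ((n + 1 : ℕ) : WithTop ℕ∞) = (n : WithTop ℕ∞) + 1 := by norm_cast
    rw [this, contDiff_succ_iff_deriv]
    refine ⟨fun x => (hd x).differentiableAt, by simp, ?_⟩
    rw [show deriv (fun x : ℝ => max (x - 1) 0 ^ (n + 1 + 1)) = _ from funext fun x => (hd x).deriv]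
    exact contDiff_const.mul ih

theorem exists_coeff (φ : ℕ → ℝ → ℝ) (hφ : ∀ n, AnalyticAt ℝ (φ n) 1)
    (ho : ∀ n, analyticOrderAt (φ n) 1 = n) (c : ℕ → ℝ) :
    ∃ a : ℕ → ℝ, ∀ n, 2 ≤ n →
      AnalyticAt ℝ (fun x => ∑ k ∈ Finset.Icc 2 n, a k * φ k x) 1 ∧
      ∀ m ≤ n, iteratedDeriv m (fun x => ∑ k ∈ Finset.Icc 2 n, a k * φ k x) 1 =
        if m < 2 then 0 else c m := by
  have h0 : ∀ n m, m < n → iteratedDeriv m (φ n) 1 = 0 := fun n =>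
    (natCast_le_analyticOrderAt_iff_iteratedDeriv_eq_zero (hφ n)).1 (ho n).ge
  have h1 : ∀ n, iteratedDeriv n (φ n) 1 ≠ 0 := fun n =>
    ((analyticOrderAt_eq_nat_iff_iteratedDeriv_eq_zero (hφ n)).1 (ho n)).2
  obtain ⟨a, ha⟩ := exists_triangular (fun n k => iteratedDeriv n (φ k) 1) (fun n _ => h1 n) c
  refine ⟨a, fun n hn => ⟨?_, fun m hm => ?_⟩⟩
  · exact Finset.analyticAt_fun_sum _ fun k _ => analyticAt_const.mul (hφ k)
  · rw [iteratedDeriv_fun_sum (fun k _ => (analyticAt_const.fun_mul (hφ k)).contDiffAt)]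
    have : ∀ k, iteratedDeriv m (fun x => a k * φ k x) 1 = a k * iteratedDeriv m (φ k) 1 :=
      fun k => iteratedDeriv_const_mul _ (hφ k).contDiffAt
    simp only [this]
    split_ifs with h
    · refine Finset.sum_eq_zero fun k hk => ?_
      rw [h0 k m (by have := (Finset.mem_Icc.1 hk).1; omega), mul_zero]
    · rw [← ha m (by omega)]
      symm
      refine Finset.sum_subset (Finset.Icc_subset_Icc_right hm) fun k hk hk' => ?_
      rw [h0 k m (by simp only [Finset.mem_Icc] at hk hk'; omega), mul_zero]

/-- The coefficients of the expansion exist. -/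
theorem exists_isExpansionCoeff : ∃ a b : ℕ → ℝ, IsExpansionCoeff a b := by
  have hA := fun n : ℕ => order_pow_div (f := fun x : ℝ => x - 1) (d := fun x => x) (by fun_prop)
    (by fun_prop) order_sub_one (by norm_num) n (n - 1)
  have hlog : AnalyticAt ℝ Real.log 1 := analyticAt_log (by norm_num)
  have hB := fun n : ℕ => order_pow_div (f := fun x : ℝ => -Real.log x)
    (d := fun x => 1 - Real.log x) hlog.neg (analyticAt_const.sub hlog) order_neg_log (by simp)
    n (n - 2)
  obtain ⟨a, ha⟩ := exists_coeff _ (fun n => (hA n).1) (fun n => (hA n).2)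
    fun n => iteratedDeriv n G 1
  obtain ⟨b, hb⟩ := exists_coeff _ (fun n => (hB n).1) (fun n => (hB n).2)
    fun n => iteratedDeriv n G 1
  refine ⟨a, b, fun n hn => ?_⟩
  obtain ⟨hA1, hA2⟩ := ha n hn
  obtain ⟨hB1, hB2⟩ := hb n hn
  set A : ℝ → ℝ := fun x => ∑ k ∈ Finset.Icc 2 n, a k * ((x - 1) ^ k / x ^ (k - 1)) with hAdef
  set B : ℝ → ℝ := fun x => ∑ k ∈ Finset.Icc 2 n,
    b k * ((-Real.log x) ^ k / (1 - Real.log x) ^ (k - 2)) with hBdef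
  have hgt : ∀ x, 1 < x → truncated a b n x = A x := by
    intro x hx
    refine Finset.sum_congr rfl fun k _ => ?_
    simp [term, hx, hx.le]
  have hlt : ∀ x, 0 < x → x < 1 → truncated a b n x = B x := by
    intro x hx0 hx
    refine Finset.sum_congr rfl fun k _ => ?_
    simp [term, hx, hx.le, hx0]
  have hA0 : A 1 = 0 := by simpa using hA2 0 (by omega)
  have hB0 : B 1 = 0 := by simpa using hB2 0 (by omega)
  have h1 : truncated a b n 1 = 0 := by simp [truncated, term]
  have hD : ((n + 1 : ℕ) : ℕ∞) ≤ analyticOrderAt (fun x => A x - B x) 1 := by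
    rw [natCast_le_analyticOrderAt_iff_iteratedDeriv_eq_zero (hA1.fun_sub hB1)]
    intro m hm
    rw [iteratedDeriv_fun_sub hA1.contDiffAt hB1.contDiffAt, hA2 m (by omega), hB2 m (by omega),
      sub_self]
  obtain ⟨h, hh, heq⟩ := (natCast_le_analyticOrderAt (hA1.fun_sub hB1)).1 hD
  have hS : truncated a b n =ᶠ[𝓝 1] fun x => B x + max (x - 1) 0 ^ (n + 1) * h x := by
    filter_upwards [heq, Ioi_mem_nhds (zero_lt_one' ℝ)] with x hx hx0
    rcases lt_trichotomy x 1 with hx1 | rfl | hx1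
    · rw [hlt x hx0 hx1, max_eq_right (by linarith)]; simp
    · simp [h1, hB0]
    · rw [hgt x hx1, max_eq_left (by linarith)]
      simp only [smul_eq_mul] at hx
      linarith
  have hC : ContDiffAt ℝ n (truncated a b n) 1 :=
    (hB1.contDiffAt.add ((contDiff_max_pow n).contDiffAt.mul hh.contDiffAt)).congr_of_eventuallyEq hS
  refine ⟨hC, ?_⟩
  have hn2 := hA2 n le_rfl
  rw [if_neg (by omega)] at hn2
  rw [← hn2, ← iteratedDerivWithin_eq_iteratedDeriv (uniqueDiffOn_Ici 1) hC Set.self_mem_Ici,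
    ← iteratedDerivWithin_eq_iteratedDeriv (uniqueDiffOn_Ici 1) hA1.contDiffAt Set.self_mem_Ici]
  refine (iteratedDerivWithin_congr ?_) Set.self_mem_Ici
  intro x hx
  rcases (Set.mem_Ici.1 hx).eq_or_lt with rfl | hx
  · rw [hA0, h1]
  · exact (hgt x hx).symm

end CostExpansion

end

/-! Put `P(y) = y G(1/y)`. Along `y = g(r)` the square root resolves, because `cosh² - sinh² = 1`
makes `η² + r` a perfect square at `η = 1/g(r)`, and the sign factor selects the right root:
`P(g(r)) = 2 - 2 cosh √r + r g(r)`, an entire function of `r`. On `(-π², 0]` the derivative of `g`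
is positive, so `P` is analytic on `(0, 1]`; letting `r → -π²` gives `P(0+) = 2 + 2 + 0 = 4`
(`perspG_g`, `analyticAt_perspG`, `tendsto_perspG`).

With `z = 1 - 1/η` the terms on `(1, ∞)` are `η a_n z^n`, so matching derivatives at `η = 1` says
exactly that `a_n` is the `n`-th Taylor coefficient at `0` of `z ↦ P(1 - z)`, those of order `0` and
`1` being zero (`iteratedDeriv_perspG`). Positivity of the `a_n` bounds the partial sums by the
limit `4` at `z = 1`, and Abel's theorem identifies the sum with that limit (`hasSum_taylorCoeff`).
-/

noncomputable section

/-! ### Everywhere convergent real power series. -/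

theorem FormalMultilinearSeries.ofScalars_radius_eq_top_of_summable {c : ℕ → ℝ}
    (h : ∀ x : ℝ, Summable fun n => c n * x ^ n) :
    (FormalMultilinearSeries.ofScalars ℝ c).radius = ⊤ := by
  refine FormalMultilinearSeries.radius_eq_top_of_summable_norm _ fun r => ?_
  refine (h r).norm.congr fun n => ?_
  rw [FormalMultilinearSeries.ofScalars_norm]
  simp

theorem hasFPowerSeriesOnBall_ofScalars {c : ℕ → ℝ} {f : ℝ → ℝ}
    (h : ∀ x : ℝ, HasSum (fun n => c n * x ^ n) (f x)) :
    HasFPowerSeriesOnBall f (FormalMultilinearSeries.ofScalars ℝ c) 0 ⊤ where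
  r_le := (FormalMultilinearSeries.ofScalars_radius_eq_top_of_summable
    fun x => (h x).summable).ge
  r_pos := by simp
  hasSum := by
    intro y _
    rw [zero_add]
    refine (h y).congr_fun ?_
    intro n
    simp [mul_comm]

theorem analyticAt_of_hasSum {c : ℕ → ℝ} {f : ℝ → ℝ}
    (h : ∀ x : ℝ, HasSum (fun n => c n * x ^ n) (f x)) (x : ℝ) : AnalyticAt ℝ f x :=
  (hasFPowerSeriesOnBall_ofScalars h).analyticAt_of_mem (by simp)

theorem hasDerivAt_zero_of_hasSum {c : ℕ → ℝ} {f : ℝ → ℝ}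
    (h : ∀ x : ℝ, HasSum (fun n => c n * x ^ n) (f x)) : HasDerivAt f (c 1) 0 := by
  have := (hasFPowerSeriesOnBall_ofScalars h).hasFPowerSeriesAt.hasDerivAt
  simpa using this

/-! ### The entire functions `g` and `coshSqrt`, and the inversion of `g`. -/

namespace CostExpansion

/-- `cosh √r`, continued analytically to `r < 0` as `cos √(-r)`. -/
def coshSqrt (r : ℝ) : ℝ :=
  if 0 ≤ r then Real.cosh (Real.sqrt r) else Real.cos (Real.sqrt (-r))

theorem g_zero : g 0 = 1 := by simp [g]

theorem g_sq {x : ℝ} (hx : 0 < x) : g (x ^ 2) = Real.sinh x / x := by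
  simp [g, Real.sqrt_sq hx.le, hx]

theorem g_neg_sq {x : ℝ} (hx : 0 < x) : g (-x ^ 2) = Real.sin x / x := by
  have h1 : ¬ 0 < -x ^ 2 := by nlinarith
  have h2 : -x ^ 2 ≠ 0 := by simp [hx.ne']
  rw [g, if_neg h1, if_neg h2, neg_neg, Real.sqrt_sq hx.le]

theorem coshSqrt_sq {x : ℝ} (hx : 0 ≤ x) : coshSqrt (x ^ 2) = Real.cosh x := by
  simp [coshSqrt, Real.sqrt_sq hx, sq_nonneg x]

theorem coshSqrt_neg_sq {x : ℝ} (hx : 0 < x) : coshSqrt (-x ^ 2) = Real.cos x := by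
  have h1 : ¬ 0 ≤ -x ^ 2 := by nlinarith
  rw [coshSqrt, if_neg h1, neg_neg, Real.sqrt_sq hx.le]

theorem coshSqrt_zero : coshSqrt 0 = 1 := by simp [coshSqrt]

theorem eq_zero_or_sq_or_neg_sq (r : ℝ) :
    r = 0 ∨ (∃ x, 0 < x ∧ r = x ^ 2) ∨ ∃ x, 0 < x ∧ r = -x ^ 2 := by
  rcases lt_trichotomy r 0 with h | h | h
  · exact .inr (.inr ⟨√(-r), Real.sqrt_pos.2 (by linarith), by
      rw [Real.sq_sqrt (by linarith)]; ring⟩)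
  · exact .inl h
  · exact .inr (.inl ⟨√r, Real.sqrt_pos.2 h, (Real.sq_sqrt h.le).symm⟩)

theorem hasSum_g (r : ℝ) :
    HasSum (fun n : ℕ => ((Nat.factorial (2 * n + 1) : ℕ) : ℝ)⁻¹ * r ^ n) (g r) := by
  rcases eq_zero_or_sq_or_neg_sq r with rfl | ⟨x, hx, rfl⟩ | ⟨x, hx, rfl⟩
  · rw [g_zero]
    convert hasSum_single (f := fun n : ℕ => ((Nat.factorial (2 * n + 1) : ℕ) : ℝ)⁻¹ * 0 ^ n) 0
      (fun n hn => by simp [hn]) using 1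
    simp
  · rw [g_sq hx]
    refine ((Real.hasSum_sinh x).div_const x).congr_fun fun n => ?_
    field_simp
    ring
  · rw [g_neg_sq hx]
    refine ((Real.hasSum_sin x).div_const x).congr_fun fun n => ?_
    rw [neg_pow]
    field_simp
    ring

theorem hasSum_coshSqrt (r : ℝ) :
    HasSum (fun n : ℕ => ((Nat.factorial (2 * n) : ℕ) : ℝ)⁻¹ * r ^ n) (coshSqrt r) := by
  rcases eq_zero_or_sq_or_neg_sq r with rfl | ⟨x, hx, rfl⟩ | ⟨x, hx, rfl⟩
  · rw [coshSqrt_zero]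
    convert hasSum_single (f := fun n : ℕ => ((Nat.factorial (2 * n) : ℕ) : ℝ)⁻¹ * 0 ^ n) 0
      (fun n hn => by simp [hn]) using 1
    simp
  · rw [coshSqrt_sq hx.le]
    refine (Real.hasSum_cosh x).congr_fun fun n => ?_
    field_simp
    ring
  · rw [coshSqrt_neg_sq hx]
    refine (Real.hasSum_cos x).congr_fun fun n => ?_
    rw [neg_pow]
    field_simp
    ring

theorem analyticAt_g (r : ℝ) : AnalyticAt ℝ g r := analyticAt_of_hasSum hasSum_g r

theorem analyticAt_coshSqrt (r : ℝ) : AnalyticAt ℝ coshSqrt r :=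
  analyticAt_of_hasSum hasSum_coshSqrt r

theorem hasDerivAt_g_zero : HasDerivAt g (1 / 6) 0 := by
  simpa [Nat.factorial] using hasDerivAt_zero_of_hasSum hasSum_g

theorem hasDerivAt_coshSqrt_zero : HasDerivAt coshSqrt (1 / 2) 0 := by
  simpa [Nat.factorial] using hasDerivAt_zero_of_hasSum hasSum_coshSqrt

/-- Unifies `cosh² = 1 + sinh²` and `cos² = 1 - sin²`. Divided by `g(r)²`, it exhibits the radicand
in `G` as a square. -/
theorem coshSqrt_sq_eq (r : ℝ) : coshSqrt r ^ 2 = 1 + r * g r ^ 2 := by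
  rcases eq_zero_or_sq_or_neg_sq r with rfl | ⟨x, hx, rfl⟩ | ⟨x, hx, rfl⟩
  · simp [coshSqrt_zero]
  · rw [coshSqrt_sq hx.le, g_sq hx, Real.cosh_sq]
    field_simp
    ring
  · rw [coshSqrt_neg_sq hx, g_neg_sq hx, Real.cos_sq']
    field_simp
    ring

/-- Differentiating along `y ↦ -y²` avoids the square roots in the definition of `g`. -/
theorem deriv_g_neg_sq {x : ℝ} (hx : 0 < x) :
    deriv g (-x ^ 2) = (Real.sin x - x * Real.cos x) / (2 * x ^ 3) := by
  have h1 : HasDerivAt (fun y : ℝ => g (-y ^ 2)) (deriv g (-x ^ 2) * -(2 * x)) x := by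
    have := (analyticAt_g (-x ^ 2)).differentiableAt.hasDerivAt
    have h2 : HasDerivAt (fun y : ℝ => -y ^ 2) (-(2 * x)) x := by
      simpa using (hasDerivAt_pow 2 x).fun_neg
    exact this.comp x h2
  have h3 : HasDerivAt (fun y : ℝ => Real.sin y / y)
      ((Real.cos x * x - Real.sin x * 1) / x ^ 2) x :=
    (Real.hasDerivAt_sin x).div (hasDerivAt_id x) hx.ne'
  have h4 : (fun y : ℝ => Real.sin y / y) =ᶠ[𝓝 x] fun y : ℝ => g (-y ^ 2) := by
    filter_upwards [Ioi_mem_nhds hx] with y hy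
    exact (g_neg_sq hy).symm
  have h5 := (h3.congr_of_eventuallyEq h4.symm).unique h1
  field_simp at h5 ⊢
  linarith

theorem mul_cos_lt_sin {x : ℝ} (hx : 0 < x) (hx' : x < Real.pi) :
    x * Real.cos x < Real.sin x := by
  rcases lt_or_ge x (Real.pi / 2) with h | h
  · have h1 := Real.lt_tan hx h
    have h2 : 0 < Real.cos x := Real.cos_pos_of_mem_Ioo ⟨by linarith, h⟩
    rwa [Real.tan_eq_sin_div_cos, lt_div_iff₀ h2] at h1
  · have h2 : Real.cos x ≤ 0 := Real.cos_nonpos_of_pi_div_two_le_of_le h (by linarith)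
    nlinarith [Real.sin_pos_of_pos_of_lt_pi hx hx']

theorem lt_pi_of_neg_pi_sq_lt {x : ℝ} (h : -Real.pi ^ 2 < -x ^ 2) : x < Real.pi := by
  nlinarith [Real.pi_pos]

theorem deriv_g_pos {r : ℝ} (hr : -Real.pi ^ 2 < r) (hr0 : r ≤ 0) : 0 < deriv g r := by
  rcases eq_zero_or_sq_or_neg_sq r with rfl | ⟨x, hx, rfl⟩ | ⟨x, hx, rfl⟩
  · rw [hasDerivAt_g_zero.deriv]; norm_num
  · nlinarith
  · rw [deriv_g_neg_sq hx]
    have := mul_cos_lt_sin hx (lt_pi_of_neg_pi_sq_lt hr)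
    exact div_pos (by linarith) (by positivity)

theorem continuous_g : Continuous g :=
  continuous_iff_continuousAt.2 fun r => (analyticAt_g r).continuousAt

/-- Left of `0` the derivative is positive; right of `0` the power series has positive coefficients
and is compared term by term. -/
theorem strictMonoOn_g : StrictMonoOn g (Set.Ioi (-Real.pi ^ 2)) := by
  have h0 : -Real.pi ^ 2 < 0 := by nlinarith [Real.pi_pos]
  have h1 : StrictMonoOn g (Set.Ioc (-Real.pi ^ 2) 0) := by
    refine strictMonoOn_of_deriv_pos (convex_Ioc _ _) continuous_g.continuousOn fun r hr => ?_
    rw [interior_Ioc] at hr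
    exact deriv_g_pos hr.1 hr.2.le
  have h2 : StrictMonoOn g (Set.Ici 0) := by
    intro r hr s hs hrs
    refine hasSum_lt (i := 1) (fun n => ?_) ?_ (hasSum_g r) (hasSum_g s)
    · have : 0 ≤ r := hr
      dsimp only
      gcongr
    · simpa [Nat.factorial] using hrs
  have h3 := h1.union h2 (c := 0) ⟨⟨h0, le_rfl⟩, fun x hx => hx.2⟩
    ⟨Set.self_mem_Ici, fun x hx => hx⟩
  rwa [Set.Ioc_union_Ici_eq_Ioi h0] at h3

theorem gInv_g {r : ℝ} (hr : -Real.pi ^ 2 < r) : gInv (g r) = r :=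
  strictMonoOn_g.injOn.leftInvOn_invFunOn hr

theorem g_pos {r : ℝ} (hr : -Real.pi ^ 2 < r) : 0 < g r := by
  rcases eq_zero_or_sq_or_neg_sq r with rfl | ⟨x, hx, rfl⟩ | ⟨x, hx, rfl⟩
  · simp [g_zero]
  · rw [g_sq hx]; exact div_pos (Real.sinh_pos_iff.2 hx) hx
  · rw [g_neg_sq hx]
    exact div_pos (Real.sin_pos_of_pos_of_lt_pi hx (lt_pi_of_neg_pi_sq_lt hr)) hx

theorem g_neg_pi_sq : g (-Real.pi ^ 2) = 0 := by simp [g_neg_sq Real.pi_pos]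

/-- On `(-π², ∞)` the only zero of `coshSqrt` is `-π²/4`, where `cos √(-r)` changes sign; this is
the role of the sign factor in `G`. -/
theorem sign_mul_abs_coshSqrt {r : ℝ} (hr : -Real.pi ^ 2 < r) :
    Real.sign (4 * r + Real.pi ^ 2) * |coshSqrt r| = coshSqrt r := by
  rcases eq_zero_or_sq_or_neg_sq r with rfl | ⟨x, hx, rfl⟩ | ⟨x, hx, rfl⟩
  · simp [coshSqrt_zero, Real.sign_of_pos, Real.pi_pos]
  · rw [coshSqrt_sq hx.le, Real.sign_of_pos (by positivity), abs_of_pos (Real.cosh_pos x), one_mul]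
  · have hpi := Real.pi_pos
    have hx' := lt_pi_of_neg_pi_sq_lt hr
    rw [coshSqrt_neg_sq hx]
    rcases lt_trichotomy x (Real.pi / 2) with h | h | h
    · rw [Real.sign_of_pos (by nlinarith),
        abs_of_pos (Real.cos_pos_of_mem_Ioo ⟨by linarith, h⟩), one_mul]
    · simp [h]
    · rw [Real.sign_of_neg (by nlinarith),
        abs_of_neg (Real.cos_neg_of_pi_div_two_lt_of_lt h (by linarith))]
      ring

/-! ### The perspective of `G`: analyticity on `(0, 1]` and limit at `0`. -/

/-- The perspective `y ↦ y G(1/y)` of `G`. -/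
def perspG (y : ℝ) : ℝ := y * G y⁻¹

theorem perspG_g {r : ℝ} (hr : -Real.pi ^ 2 < r) :
    perspG (g r) = 2 - 2 * coshSqrt r + r * g r := by
  have hg := g_pos hr
  have h1 : g r * √((g r)⁻¹ ^ 2 + r) = |coshSqrt r| := by
    rw [← Real.sqrt_sq_eq_abs, coshSqrt_sq_eq]
    nth_rewrite 1 [← Real.sqrt_sq hg.le]
    rw [← Real.sqrt_mul (sq_nonneg _)]
    congr 1
    field_simp
  rw [perspG, G, inv_inv, gInv_g hr]
  have h2 := sign_mul_abs_coshSqrt hr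
  rw [← h1] at h2
  have h3 : g r * (g r)⁻¹ = 1 := mul_inv_cancel₀ hg.ne'
  linear_combination 2 * h3 - 2 * h2

/-- Every `y` in `(0, 1]` is `g(r)` with `r` in `(-π², 0]`, where `g' ≠ 0` makes `g` a local
analytic change of variable, so analyticity can be tested on `perspG ∘ g`. -/
theorem analyticAt_perspG {y : ℝ} (hy : 0 < y) (hy1 : y ≤ 1) : AnalyticAt ℝ perspG y := by
  have hc : y ∈ g '' Set.Ioc (-Real.pi ^ 2) 0 :=
    intermediate_value_Ioc (by nlinarith [Real.pi_pos]) continuous_g.continuousOn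
      (by rw [g_neg_pi_sq, g_zero]; exact ⟨hy, hy1⟩)
  obtain ⟨r, hr, rfl⟩ := hc
  rw [← analyticAt_comp_iff_of_deriv_ne_zero (analyticAt_g r) (deriv_g_pos hr.1 hr.2).ne']
  have h : AnalyticAt ℝ (fun r => 2 - 2 * coshSqrt r + r * g r) r := by
    have := analyticAt_g r
    have := analyticAt_coshSqrt r
    fun_prop
  refine h.congr ?_
  filter_upwards [Ioi_mem_nhds hr.1] with s hs
  exact (perspG_g hs).symm

theorem perspG_one : perspG 1 = 0 := by
  have h := perspG_g (r := 0) (by nlinarith [Real.pi_pos])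
  rw [g_zero, coshSqrt_zero] at h
  linarith

/-- In the variable `r` the derivative at `0` is `-1 + g(0) = 0`. The expansion has no term of order
`1`, and its defining condition starts at order `2`, so this needs a separate check. -/
theorem hasDerivAt_perspG_one : HasDerivAt perspG 0 1 := by
  have h1 := (analyticAt_perspG one_pos le_rfl).differentiableAt.hasDerivAt
  have h2 : HasDerivAt (perspG ∘ g) (deriv perspG 1 * (1 / 6)) 0 := by
    exact HasDerivAt.comp 0 (by rwa [g_zero]) hasDerivAt_g_zero
  have h3 : HasDerivAt (fun r => 2 - 2 * coshSqrt r + r * g r)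
      (-(2 * (1 / 2)) + (1 * g 0 + 0 * (1 / 6))) 0 :=
    ((hasDerivAt_coshSqrt_zero.const_mul 2).const_sub 2).add
      ((hasDerivAt_id (0 : ℝ)).mul hasDerivAt_g_zero)
  have h4 : perspG ∘ g =ᶠ[𝓝 0] fun r => 2 - 2 * coshSqrt r + r * g r := by
    filter_upwards [Ioi_mem_nhds (show -Real.pi ^ 2 < 0 by nlinarith [Real.pi_pos])] with s hs
    exact perspG_g hs
  have h5 := (h3.congr_of_eventuallyEq h4).unique h2
  rw [g_zero] at h5
  have h6 : deriv perspG 1 = 0 := by linarith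
  rwa [h6] at h1

theorem tendsto_perspG : Tendsto perspG (𝓝[>] 0) (𝓝 4) := by
  have hpi : -Real.pi ^ 2 < 0 := by nlinarith [Real.pi_pos]
  have hF : Tendsto (fun r => 2 - 2 * coshSqrt r + r * g r) (𝓝 (-Real.pi ^ 2)) (𝓝 4) := by
    have h : ContinuousAt (fun r => 2 - 2 * coshSqrt r + r * g r) (-Real.pi ^ 2) := by
      have := (analyticAt_g (-Real.pi ^ 2)).continuousAt
      have := (analyticAt_coshSqrt (-Real.pi ^ 2)).continuousAt
      fun_prop
    have h' := h.tendsto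
    rw [g_neg_pi_sq, coshSqrt_neg_sq Real.pi_pos, Real.cos_pi] at h'
    convert h' using 2
    norm_num
  -- Continuity of `gInv` is not needed: by the intermediate value theorem every small `y > 0` is
  -- `g(r)` for some `r` close to `-π²`.
  intro s hs
  obtain ⟨c, hc, hcs⟩ := (mem_nhdsGT_iff_exists_Ioo_subset' hpi).1
    (mem_nhdsWithin_of_mem_nhds (hF hs))
  rw [mem_map]
  filter_upwards [Ioo_mem_nhdsGT (g_pos (Set.mem_Ioi.1 hc))] with y hy
  obtain ⟨r, hr, rfl⟩ := intermediate_value_Ioo (Set.mem_Ioi.1 hc).le continuous_g.continuousOn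
    (show y ∈ Set.Ioo (g (-Real.pi ^ 2)) (g c) by rwa [g_neg_pi_sq])
  rw [Set.mem_preimage, perspG_g hr.1]
  exact hcs hr

end CostExpansion
end

/-! ### Analytic functions with nonnegative Taylor coefficients. -/

noncomputable section

theorem HasFPowerSeriesOnBall.iteratedDeriv_nonneg {f : ℝ → ℝ} {p : FormalMultilinearSeries ℝ ℝ ℝ}
    {y t : ℝ} {r : ENNReal} (hf : HasFPowerSeriesOnBall f p y r)
    (h : ∀ k, 0 ≤ iteratedDeriv k f y) (hyt : y ≤ t) (ht : t ∈ Metric.eball y r) (n : ℕ) :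
    0 ≤ iteratedDeriv n f t := by
  induction n generalizing f p with
  | zero =>
    have hs := hf.hasSum_iteratedFDeriv (y := t - y)
      (by simpa [edist_eq_enorm_sub] using ht)
    rw [add_sub_cancel] at hs
    rw [iteratedDeriv_zero]
    refine hs.nonneg fun k => ?_
    rw [iteratedFDeriv_apply_eq_iteratedDeriv_mul_prod]
    have := h k
    have : 0 ≤ t - y := sub_nonneg.2 hyt
    simp only [Finset.prod_const, smul_eq_mul]
    positivity
  | succ n ih =>
    rw [iteratedDeriv_succ']
    -- The derivative expands on the same ball, so the induction hypothesis applies to it.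
    have hd := (ContinuousLinearMap.apply ℝ ℝ (1 : ℝ)).comp_hasFPowerSeriesOnBall hf.fderiv
    refine ih (f := deriv f) hd fun k => ?_
    rw [← iteratedDeriv_succ']
    exact h (k + 1)

/-- For a function analytic on `[a, b)`, nonnegativity of all derivatives at `a` propagates to the
whole interval. -/
theorem AnalyticOnNhd.iteratedDeriv_nonneg {f : ℝ → ℝ} {a b : ℝ}
    (hf : AnalyticOnNhd ℝ f (Set.Ico a b)) (h : ∀ k, 0 ≤ iteratedDeriv k f a) {x : ℝ}
    (hx : x ∈ Set.Ico a b) (n : ℕ) : 0 ≤ iteratedDeriv n f x := by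
  have hsub : Set.Icc a x ⊆ Set.Ico a b := fun t ht => ⟨ht.1, ht.2.trans_lt hx.2⟩
  have hcl : IsClosed ({t | ∀ k, 0 ≤ iteratedDeriv k f t} ∩ Set.Icc a x) := by
    have he : {t | ∀ k, 0 ≤ iteratedDeriv k f t} ∩ Set.Icc a x =
        ⋂ k, Set.Icc a x ∩ iteratedDeriv k f ⁻¹' Set.Ici 0 := by
      ext t
      simp only [Set.mem_inter_iff, Set.mem_ofPred_eq, Set.mem_iInter, Set.mem_preimage,
        Set.mem_Ici]
      exact ⟨fun h k => ⟨h.2, h.1 k⟩, fun h => ⟨fun k => (h k).2, (h 0).1⟩⟩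
    rw [he]
    refine isClosed_iInter fun k => ContinuousOn.preimage_isClosed_of_isClosed ?_ isClosed_Icc
      isClosed_Ici
    exact fun t ht => (by
    rw [iteratedDeriv_eq_iterate]
    exact (hf t (hsub ht)).iterated_deriv k : AnalyticAt ℝ (iteratedDeriv k f) t).continuousAt.continuousWithinAt
  -- Continuous induction: the good set is closed and, by expanding in a power series at one of its
  -- points, contains points immediately to the right.
  refine hcl.Icc_subset_of_forall_mem_nhdsWithin h (fun t ht => ?_) ⟨hx.1, le_rfl⟩ n
  obtain ⟨p, r, hp⟩ := hf t (hsub ⟨ht.2.1, ht.2.2.le⟩)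
  filter_upwards [mem_nhdsWithin_of_mem_nhds (Metric.eball_mem_nhds t hp.r_pos),
    self_mem_nhdsWithin] with s hs hts
  exact fun k => hp.iteratedDeriv_nonneg ht.1 (Set.mem_Ioi.1 hts).le hs k

/-- The Lagrange remainder is nonnegative, since all derivatives are nonnegative on `[a, b)`. -/
theorem AnalyticOnNhd.sum_taylor_le {f : ℝ → ℝ} {a b : ℝ}
    (hf : AnalyticOnNhd ℝ f (Set.Ico a b)) (h : ∀ k, 0 ≤ iteratedDeriv k f a) {x : ℝ}
    (hx : x ∈ Set.Ioo a b) (n : ℕ) :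
    ∑ k ∈ Finset.range (n + 1), iteratedDeriv k f a / (Nat.factorial k) * (x - a) ^ k ≤ f x := by
  have hsub : Set.uIcc a x ⊆ Set.Ico a b := by
    rw [Set.uIcc_of_le hx.1.le]
    exact fun t ht => ⟨ht.1, ht.2.trans_lt hx.2⟩
  obtain ⟨t, ht, he⟩ := taylor_mean_remainder_lagrange_iteratedDeriv (n := n) (f := f) hx.1.ne
    fun t ht => (hf t (hsub ht)).contDiffAt.contDiffWithinAt
  have hnn : 0 ≤ f x - taylorWithinEval f n (Set.uIcc a x) a x := by
    rw [he]
    have h1 : 0 ≤ iteratedDeriv (n + 1) f t :=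
      hf.iteratedDeriv_nonneg h (hsub (Set.Ioo_subset_Icc_self ht)) _
    have h2 : 0 ≤ x - a := sub_nonneg.2 hx.1.le
    positivity
  rw [taylor_within_apply] at hnn
  refine le_trans (le_of_eq ?_) (sub_nonneg.1 hnn)
  refine Finset.sum_congr rfl fun k _ => ?_
  rw [iteratedDerivWithin_eq_iteratedDeriv (uniqueDiffOn_uIcc hx.1.ne)
    (hf a ⟨le_rfl, hx.1.trans hx.2⟩).contDiffAt Set.left_mem_uIcc, smul_eq_mul]
  field_simp

/-- If `f` is analytic on `[0, 1)`, has nonnegative Taylor coefficients at `0` and tends to `L` at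
`1` from the left, then its Taylor coefficients sum to `L`. -/
theorem AnalyticOnNhd.hasSum_taylorCoeff {f : ℝ → ℝ} {L : ℝ}
    (hf : AnalyticOnNhd ℝ f (Set.Ico 0 1)) (h : ∀ k, 0 ≤ iteratedDeriv k f 0)
    (hL : Tendsto f (𝓝[<] 1) (𝓝 L)) :
    HasSum (fun k => iteratedDeriv k f 0 / (Nat.factorial k)) L := by
  set c : ℕ → ℝ := fun k => iteratedDeriv k f 0 / (Nat.factorial k) with hc
  have hc0 : ∀ k, 0 ≤ c k := fun k => div_nonneg (h k) (by positivity)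
  have hle : ∀ n, ∑ k ∈ Finset.range n, c k ≤ L := by
    intro n
    have h1 : Tendsto (fun x : ℝ => ∑ k ∈ Finset.range (n + 1), c k * x ^ k) (𝓝[<] 1)
        (𝓝 (∑ k ∈ Finset.range (n + 1), c k * 1 ^ k)) :=
      (Continuous.tendsto (by fun_prop) 1).mono_left nhdsWithin_le_nhds
    have h2 : ∑ k ∈ Finset.range (n + 1), c k * 1 ^ k ≤ L := by
      refine le_of_tendsto_of_tendsto h1 hL ?_
      filter_upwards [Ioo_mem_nhdsLT (zero_lt_one' ℝ)] with x hx
      simpa using hf.sum_taylor_le h hx n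
    rw [Finset.sum_range_succ] at h2
    simp only [one_pow, mul_one] at h2
    linarith [hc0 n]
  have hsum : Summable c := summable_of_sum_range_le hc0 hle
  -- Summability gives radius at least `1`; the identity theorem then extends the equality of `f`
  -- with its Taylor series from near `0` to `[0, 1)`, and Abel's theorem passes to `1`.
  let p := FormalMultilinearSeries.ofScalars ℝ c
  have hr : ((1 : NNReal) : ENNReal) ≤ p.radius := by
    refine p.le_radius_of_summable_norm ?_
    refine hsum.norm.congr fun n => ?_
    simp [p]
  have hp : HasFPowerSeriesOnBall p.sum p 0 p.radius :=
    p.hasFPowerSeriesOnBall (lt_of_lt_of_le (by simp) hr)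
  have hpsum : ∀ x, p.sum x = ∑' n, c n * x ^ n := fun x =>
    tsum_congr fun n => by simp [p, mul_comm]
  have hpan : AnalyticOnNhd ℝ p.sum (Set.Ico 0 1) := by
    intro x hx
    refine hp.analyticAt_of_mem (Metric.eball_subset_eball hr ?_)
    rw [ENNReal.coe_one, Metric.mem_eball, edist_dist, Real.dist_0_eq_abs, abs_of_nonneg hx.1]
    simpa using hx.2
  have hz : (0 : ℝ) ∈ Set.Ico (0 : ℝ) 1 := ⟨le_rfl, one_pos⟩
  have heq : f =ᶠ[𝓝 0] p.sum := by
    have h1 := (hf 0 hz).hasFPowerSeriesAt.eventually_hasSum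
    have h2 := hp.hasFPowerSeriesAt.eventually_hasSum
    filter_upwards [h1, h2] with x hx1 hx2
    rw [zero_add] at hx1 hx2
    exact hx1.unique hx2
  have hEq := hf.eqOn_of_preconnected_of_eventuallyEq hpan isPreconnected_Ico hz heq
  have habel := Real.tendsto_tsum_powerSeries_nhdsWithin_lt hsum.hasSum.tendsto_sum_nat
  have h3 : Tendsto f (𝓝[<] 1) (𝓝 (∑' n, c n)) := by
    refine habel.congr' ?_
    filter_upwards [Ioo_mem_nhdsLT (zero_lt_one' ℝ)] with x hx
    rw [hEq ⟨hx.1.le, hx.2⟩, hpsum]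
  rw [tendsto_nhds_unique hL h3]
  exact hsum.hasSum

end

/-! ### The `a n` as Taylor coefficients of `z ↦ perspG (1 - z)`. -/

noncomputable section

namespace CostExpansion

/-- The restriction of the truncated expansion to `(1, ∞)`. -/
def truncatedRight (a : ℕ → ℝ) (n : ℕ) (x : ℝ) : ℝ :=
  ∑ k ∈ Finset.Icc 2 n, a k * ((x - 1) ^ k / x ^ (k - 1))

theorem truncated_eq_truncatedRight (a b : ℕ → ℝ) (n : ℕ) {x : ℝ} (hx : 1 ≤ x) :
    truncated a b n x = truncatedRight a n x := by
  refine Finset.sum_congr rfl fun k hk => ?_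
  rcases hx.eq_or_lt with rfl | hx
  · have := (Finset.mem_Icc.1 hk).1
    simp [term, show k ≠ 0 by omega]
  · simp [term, hx, hx.le]

theorem truncatedRight_eq (a : ℕ → ℝ) (n : ℕ) {x : ℝ} (hx : x ≠ 0) :
    truncatedRight a n x = x * ∑ k ∈ Finset.Icc 2 n, a k * (1 - x⁻¹) ^ k := by
  rw [truncatedRight, Finset.mul_sum]
  refine Finset.sum_congr rfl fun k hk => ?_
  obtain ⟨m, rfl⟩ : ∃ m, k = m + 1 := ⟨k - 1, by have := (Finset.mem_Icc.1 hk).1; omega⟩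
  rw [show 1 - x⁻¹ = (x - 1) / x by field_simp, div_pow, Nat.add_sub_cancel]
  field_simp
  ring

theorem analyticAt_rightTerm (k : ℕ) : AnalyticAt ℝ (fun x : ℝ => (x - 1) ^ k / x ^ (k - 1)) 1 :=
  (order_pow_div (f := fun x : ℝ => x - 1) (d := fun x => x) (by fun_prop)
    (by fun_prop) order_sub_one (by norm_num) k (k - 1)).1

theorem iteratedDeriv_rightTerm {m k : ℕ} (h : m < k) :
    iteratedDeriv m (fun x : ℝ => (x - 1) ^ k / x ^ (k - 1)) 1 = 0 :=
  (natCast_le_analyticOrderAt_iff_iteratedDeriv_eq_zero (analyticAt_rightTerm k)).1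
    (order_pow_div (f := fun x : ℝ => x - 1) (d := fun x => x) (by fun_prop)
      (by fun_prop) order_sub_one (by norm_num) k (k - 1)).2.ge m h

theorem analyticAt_truncatedRight (a : ℕ → ℝ) (n : ℕ) : AnalyticAt ℝ (truncatedRight a n) 1 :=
  Finset.analyticAt_fun_sum _ fun k _ => analyticAt_const.mul (analyticAt_rightTerm k)

theorem iteratedDeriv_truncatedRight (a : ℕ → ℝ) (m n : ℕ) :
    iteratedDeriv m (truncatedRight a n) 1 =
      ∑ k ∈ Finset.Icc 2 n,
        a k * iteratedDeriv m (fun x : ℝ => (x - 1) ^ k / x ^ (k - 1)) 1 := by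
  unfold truncatedRight
  rw [iteratedDeriv_fun_sum
    (fun k _ => (analyticAt_const.fun_mul (analyticAt_rightTerm k)).contDiffAt)]
  exact Finset.sum_congr rfl fun k _ =>
    iteratedDeriv_const_mul _ (analyticAt_rightTerm k).contDiffAt

theorem iteratedDeriv_truncatedRight_of_le (a : ℕ → ℝ) {m n : ℕ} (h : m ≤ n) :
    iteratedDeriv m (truncatedRight a n) 1 = iteratedDeriv m (truncatedRight a m) 1 := by
  rw [iteratedDeriv_truncatedRight, iteratedDeriv_truncatedRight]
  symm
  refine Finset.sum_subset (Finset.Icc_subset_Icc_right h) fun k hk hk' => ?_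
  rw [iteratedDeriv_rightTerm (by simp only [Finset.mem_Icc] at hk hk'; omega), mul_zero]

/-- Since the truncated expansion is smooth enough at `1`, its derivative there can be computed
within `[1, ∞)`, where the `b` terms vanish. -/
theorem IsExpansionCoeff.iteratedDeriv_G {a b : ℕ → ℝ} (hab : IsExpansionCoeff a b) {n : ℕ}
    (hn : 2 ≤ n) : iteratedDeriv n G 1 = iteratedDeriv n (truncatedRight a n) 1 := by
  obtain ⟨hC, he⟩ := hab n hn
  rw [he, ← iteratedDerivWithin_eq_iteratedDeriv (uniqueDiffOn_Ici 1) hC Set.self_mem_Ici,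
    ← iteratedDerivWithin_eq_iteratedDeriv (uniqueDiffOn_Ici 1)
      (analyticAt_truncatedRight a n).contDiffAt Set.self_mem_Ici]
  exact iteratedDerivWithin_congr (fun x hx => truncated_eq_truncatedRight a b n hx)
    Set.self_mem_Ici

theorem G_eq_mul_perspG {x : ℝ} (hx : x ≠ 0) : G x = x * perspG x⁻¹ := by
  rw [perspG, inv_inv, mul_inv_cancel_left₀ hx]

theorem G_eventuallyEq : G =ᶠ[𝓝 1] fun x => x * perspG x⁻¹ := by
  filter_upwards [isOpen_ne.mem_nhds (one_ne_zero' ℝ)] with x hx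
  exact G_eq_mul_perspG hx

theorem analyticAt_G_one : AnalyticAt ℝ G 1 := by
  refine AnalyticAt.congr ?_ G_eventuallyEq.symm
  refine analyticAt_id.mul (AnalyticAt.comp (g := perspG) ?_ (analyticAt_inv one_ne_zero))
  rw [inv_one]
  exact analyticAt_perspG one_pos le_rfl

theorem G_one : G 1 = 0 := by
  rw [G_eq_mul_perspG one_ne_zero, inv_one, perspG_one, mul_zero]

theorem deriv_G_one : deriv G 1 = 0 := by
  rw [G_eventuallyEq.deriv_eq]
  have h1 : HasDerivAt perspG 0 (1 : ℝ)⁻¹ := by rw [inv_one]; exact hasDerivAt_perspG_one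
  have h2 := (hasDerivAt_id (1 : ℝ)).mul (h1.comp 1 (hasDerivAt_inv one_ne_zero))
  refine h2.deriv.trans ?_
  simp [perspG_one]

theorem IsExpansionCoeff.le_analyticOrderAt {a b : ℕ → ℝ} (hab : IsExpansionCoeff a b) (n : ℕ) :
    ((n + 1 : ℕ) : ℕ∞) ≤ analyticOrderAt (fun x => G x - truncatedRight a n x) 1 := by
  rw [natCast_le_analyticOrderAt_iff_iteratedDeriv_eq_zero
    (analyticAt_G_one.fun_sub (analyticAt_truncatedRight a n))]
  intro m hm
  rw [iteratedDeriv_fun_sub analyticAt_G_one.contDiffAt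
    (analyticAt_truncatedRight a n).contDiffAt, sub_eq_zero,
    iteratedDeriv_truncatedRight_of_le a (Nat.lt_succ_iff.1 hm)]
  rcases lt_or_ge m 2 with h | h
  · have h0 : truncatedRight a m = fun _ => 0 := by
      ext x
      rw [truncatedRight, Finset.Icc_eq_empty (by omega), Finset.sum_empty]
    rw [h0]
    interval_cases m
    · simp [G_one]
    · simp [iteratedDeriv_one, deriv_G_one]
  · exact hab.iteratedDeriv_G h

/-- The change of variable `η = 1/(1 - z)` has `η - 1 = z/(1 - z)`, so contact of order `m + 1` at
`η = 1` becomes contact of the same order at `z = 0`, after dividing by `η`. -/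
theorem IsExpansionCoeff.iteratedDeriv_perspG {a b : ℕ → ℝ} (hab : IsExpansionCoeff a b) (m : ℕ) :
    iteratedDeriv m (fun z => perspG (1 - z)) 0 =
      if 2 ≤ m then (Nat.factorial m) * a m else 0 := by
  have hP : AnalyticAt ℝ (fun z => perspG (1 - z)) 0 := by
    refine AnalyticAt.comp (g := perspG) ?_ (by fun_prop)
    rw [sub_zero]
    exact analyticAt_perspG one_pos le_rfl
  have hQ : AnalyticAt ℝ (fun z : ℝ => ∑ k ∈ Finset.Icc 2 m, a k * z ^ k) 0 := by fun_prop
  have hord : ((m + 1 : ℕ) : ℕ∞) ≤ analyticOrderAt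
      (fun z : ℝ => perspG (1 - z) - ∑ k ∈ Finset.Icc 2 m, a k * z ^ k) 0 := by
    obtain ⟨h, hh, heq⟩ := (natCast_le_analyticOrderAt
      (analyticAt_G_one.fun_sub (analyticAt_truncatedRight a m))).1 (hab.le_analyticOrderAt m)
    have hinv : AnalyticAt ℝ (fun z : ℝ => (1 - z)⁻¹) 0 :=
      AnalyticAt.inv (by fun_prop) (by norm_num)
    have hh' : AnalyticAt ℝ (fun z : ℝ => h (1 - z)⁻¹) 0 :=
      AnalyticAt.comp (g := h) (by simpa using hh) hinv
    refine (natCast_le_analyticOrderAt (hP.fun_sub hQ)).2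
      ⟨fun z => (1 - z) * ((1 - z)⁻¹ ^ (m + 1) * h (1 - z)⁻¹),
        AnalyticAt.fun_mul (by fun_prop) ((hinv.fun_pow _).fun_mul hh'), ?_⟩
    have ht : Tendsto (fun z : ℝ => (1 - z)⁻¹) (𝓝 0) (𝓝 1) := by
      simpa using hinv.continuousAt.tendsto
    filter_upwards [ht.eventually heq, Iio_mem_nhds (zero_lt_one' ℝ)] with z hz hz1
    have hz0 : (1 - z : ℝ) ≠ 0 := by have := Set.mem_Iio.1 hz1; linarith
    rw [G_eq_mul_perspG (inv_ne_zero hz0), truncatedRight_eq a m (inv_ne_zero hz0), inv_inv,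
      sub_sub_cancel, ← mul_sub, smul_eq_mul] at hz
    have hz2 : (1 - z)⁻¹ - 1 = z * (1 - z)⁻¹ := by field_simp; ring
    rw [inv_mul_eq_iff_eq_mul₀ hz0, hz2, mul_pow] at hz
    rw [hz, sub_zero, smul_eq_mul]
    ring
  have h0 := (natCast_le_analyticOrderAt_iff_iteratedDeriv_eq_zero (hP.fun_sub hQ)).1 hord m
    (Nat.lt_succ_self m)
  rw [iteratedDeriv_fun_sub hP.contDiffAt hQ.contDiffAt, sub_eq_zero] at h0
  rw [h0, iteratedDeriv_fun_sum (fun k _ => ContDiff.contDiffAt (by fun_prop))]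
  have : ∀ k, iteratedDeriv m (fun z : ℝ => a k * z ^ k) 0 =
      if k = m then (Nat.factorial m) * a m else 0 := fun k => by
    rw [iteratedDeriv_const_mul _ (ContDiff.contDiffAt (by fun_prop)), iteratedDeriv_fun_pow_zero]
    by_cases hk : k = m
    · subst hk
      simp [mul_comm]
    · simp [hk, Ne.symm hk]
  simp only [this, Finset.sum_ite_eq', Finset.mem_Icc, le_refl, and_true]

theorem IsExpansionCoeff.hasSum {a b : ℕ → ℝ} (hab : IsExpansionCoeff a b)
    (hpos : ∀ n : ℕ, 2 ≤ n → 0 < a n) : HasSum (fun n => if 2 ≤ n then a n else 0) 4 := by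
  have han : AnalyticOnNhd ℝ (fun z => perspG (1 - z)) (Set.Ico 0 1) := fun z hz =>
    AnalyticAt.comp (g := perspG)
      (analyticAt_perspG (by linarith [hz.2]) (by linarith [hz.1])) (by fun_prop)
  have ht : Tendsto (fun z : ℝ => 1 - z) (𝓝[<] 1) (𝓝[>] 0) := by
    refine tendsto_nhdsWithin_iff.2 ⟨?_, ?_⟩
    · have : Tendsto (fun z : ℝ => 1 - z) (𝓝 1) (𝓝 (1 - 1)) :=
        Continuous.tendsto (by fun_prop) 1
      rw [sub_self] at this
      exact this.mono_left nhdsWithin_le_nhds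
    · filter_upwards [self_mem_nhdsWithin] with z hz
      exact sub_pos.2 (Set.mem_Iio.1 hz)
  refine (han.hasSum_taylorCoeff (fun k => ?_) (tendsto_perspG.comp ht)).congr_fun fun k => ?_
  · rw [hab.iteratedDeriv_perspG]
    split_ifs with hk
    · have := hpos k hk
      positivity
    · exact le_rfl
  · rw [hab.iteratedDeriv_perspG]
    split_ifs with hk
    · field_simp
    · simp

/-! ### Asymptotics at infinity and conclusion. -/

theorem isEquivalent_G : G ~[atTop] fun η : ℝ => 4 * η := by
  refine (isEquivalent_iff_tendsto_one ?_).2 ?_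
  · filter_upwards [eventually_gt_atTop (0 : ℝ)] with η hη
    positivity
  · have h : Tendsto (fun η : ℝ => perspG η⁻¹ / 4) atTop (𝓝 (4 / 4)) :=
      (tendsto_perspG.comp tendsto_inv_atTop_nhdsGT_zero).div_const 4
    rw [div_self (by norm_num)] at h
    refine h.congr' ?_
    filter_upwards [eventually_gt_atTop (0 : ℝ)] with η hη
    rw [Pi.div_apply, G_eq_mul_perspG hη.ne']
    field_simp

/-- For `η ≥ 1`, the truncation divided by `η` is a polynomial in `1/η` with constant term the sum
of the `a n`. -/
theorem isEquivalent_truncated (a b : ℕ → ℝ) (N : ℕ) (ha : ∑ n ∈ Finset.Icc 2 N, a n ≠ 0) :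
    truncated a b N ~[atTop] fun η : ℝ => (∑ n ∈ Finset.Icc 2 N, a n) * η := by
  refine (isEquivalent_iff_tendsto_one ?_).2 ?_
  · filter_upwards [eventually_gt_atTop (0 : ℝ)] with η hη
    exact mul_ne_zero ha hη.ne'
  · have hc : Continuous fun y : ℝ =>
        (∑ k ∈ Finset.Icc 2 N, a k * (1 - y) ^ k) / ∑ n ∈ Finset.Icc 2 N, a n := by fun_prop
    have h := (hc.tendsto 0).comp tendsto_inv_atTop_zero
    simp only [sub_zero, one_pow, mul_one, div_self ha] at h
    refine h.congr' ?_
    filter_upwards [eventually_ge_atTop (1 : ℝ)] with η hη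
    have hη0 : η ≠ 0 := by linarith
    rw [Pi.div_apply, truncated_eq_truncatedRight a b N hη, truncatedRight_eq a N hη0,
      Function.comp_apply, mul_comm η, mul_div_mul_right _ _ hη0]

end CostExpansion
end

theorem corollary3p4 (a b : ℕ → ℝ) (hab : CostExpansion.IsExpansionCoeff a b)
    (hpos : ∀ n : ℕ, 2 ≤ n → 0 < a n) :
    Tendsto (fun N : ℕ => ∑ n ∈ Finset.Icc 2 N, a n) atTop (𝓝 4) ∧
    CostExpansion.G ~[atTop] (fun η : ℝ => 4 * η) ∧
    ∀ N : ℕ, 2 ≤ N →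
      CostExpansion.truncated a b N ~[atTop] (fun η : ℝ => (∑ n ∈ Finset.Icc 2 N, a n) * η) := by
  refine ⟨?_, CostExpansion.isEquivalent_G, fun N hN => ?_⟩
  -- The shift by one turns sums over `range (N + 1)` into sums over `Icc 2 N`.
  · have h := (hab.hasSum hpos).tendsto_sum_nat.comp (tendsto_add_atTop_nat 1)
    refine h.congr fun N => ?_
    rw [Function.comp_apply, ← Finset.sum_filter]
    refine Finset.sum_congr ?_ fun _ _ => rfl
    ext k
    simp only [Finset.mem_filter, Finset.mem_range, Finset.mem_Icc]
    omega
  · refine CostExpansion.isEquivalent_truncated a b N (Finset.sum_pos (fun n hn => ?_) ?_).ne'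
    · exact hpos n (Finset.mem_Icc.1 hn).1
    · exact ⟨2, Finset.mem_Icc.2 ⟨le_rfl, hN⟩⟩
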